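/- Let $k\ge 1$ be an integer, let $$Y_k=\{z\in\mathbb C^4 : z_1^2+z_2^2+z_3^2-z_4^{2k}=0\},\qquad S_k=\{z\in\mathbb C^4 : z_1-iz_2=z_3-z_4^k=0\},$$ let $N_k\to\mathbb C^4$ be the blow-up with center the smooth surface $S_k$, let $W_k\subset N_k$ be the strict transform of $Y_k$, and let $f_k:W_k\to Y_k$ be the restriction of the blow-down map. Explicitly, $N_k$ is the set of all $(z,[p:q])\in\mathbb C^4\times\mathbb{CP}_1$ with $q(z_1-iz_2)=p(z_3-z_4^k)$, and $W_k$ is the closure in $N_k$ of the preimage of $Y_k\setminus S_k$; it is a complex threefold, covered by the two charts $$\Bigl(\zeta=\tfrac qp,\ x_1=\tfrac{z_1-iz_2}{2},\ x_2=z_4\Bigr)\quad (p\ne0),\qquad \Bigl(w=\tfrac pq,\ y_1=-\tfrac{z_1+iz_2}{2},\ y_2=z_4\Bigr)\quad (q\neq 0),$$ each with image $\mathbb C^3$, with coordinate change $w=1/\zeta$, $y_1=\zeta^2x_1+\zeta x_2^k$, $y_2=x_2$. Let $C_k=f_k^{-1}(0)$ be the exceptional curve, $B=\{z\in Y_k\cap\mathbb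 R^4 : z_4>0\}$ and $A=f_k^{-1}(B)\subset W_k$. Then $A$ is a real threefold in $W_k$ with boundary $\partial A=C_k$. That is: the closure of $A$ in $W_k$ is the disjoint union $\overline A=A\sqcup C_k$, and $\overline A$ is a smoothly embedded real $3$-dimensional $C^\infty$ submanifold with boundary of $W_k$ (viewed as a real smooth manifold), whose set of interior points is $A$ and whose boundary is $C_k$. -/

import Mathlib

open scoped Manifold ContDiff LinearAlgebra.Projectivization

noncomputable section

namespace OneConvex

open Complex Set Topology

/-- The complex projective line, as the space of lines through `0` in `ℂ²`. -/
abbrev P1 : Type := ℙ ℂ (Fin 2 → ℂ)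

/-- The quotient topology of `ℂ² \ {0} → ℂℙ₁`. -/
instance : TopologicalSpace P1 :=
  TopologicalSpace.coinduced
    (fun v : {v : Fin 2 → ℂ // v ≠ 0} => Projectivization.mk ℂ v.1 v.2) inferInstance

/-- Coordinates of `ℂ⁴`: `z 0, z 1, z 2, z 3` stand for `z₁, z₂, z₃, z₄`.
The hypersurface `Y_k = {z₁² + z₂² + z₃² - z₄^{2k} = 0}`. -/
def Y (k : ℕ) : Set (Fin 4 → ℂ) :=
  {z | z 0 ^ 2 + z 1 ^ 2 + z 2 ^ 2 - z 3 ^ (2 * k) = 0}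

/-- The pair of functions `(z₁ - i z₂, z₃ - z₄^k)`, whose common zero set is the surface `S_k`. -/
def centerEq (k : ℕ) (z : Fin 4 → ℂ) : Fin 2 → ℂ :=
  ![z 0 - I * z 1, z 2 - z 3 ^ k]

/-- The smooth surface `S_k = {z₁ - i z₂ = z₃ - z₄^k = 0}`. -/
def S (k : ℕ) : Set (Fin 4 → ℂ) :=
  {z | z 0 - I * z 1 = 0 ∧ z 2 - z 3 ^ k = 0}

/-- The blow-up `N_k` of `ℂ⁴` with center `S_k`: the pairs `(z, ℓ)` such that
`(z₁ - i z₂, z₃ - z₄^k)` lies on the line `ℓ`; that is, with `ℓ = [p : q]`, such that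
`q (z₁ - i z₂) = p (z₃ - z₄^k)`. -/
def blowUp (k : ℕ) : Set ((Fin 4 → ℂ) × P1) :=
  {x | centerEq k x.1 ∈ x.2.submodule}

/-- The blow-down map `f_k : N_k → ℂ⁴`. -/
def blowDown (k : ℕ) (x : blowUp k) : Fin 4 → ℂ := x.1.1

/-- The strict transform of `Y_k`: the closure in `N_k` of the preimage of `Y_k \ S_k`. -/
def strictTransform (k : ℕ) : Set (blowUp k) :=
  closure (blowDown k ⁻¹' (Y k \ S k))

/-- The threefold `W_k`, with the topology induced from `N_k`. Its complex structure
is given below. -/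
abbrev W (k : ℕ) : Type := strictTransform k

/-- The restriction `f_k : W_k → Y_k ⊆ ℂ⁴` of the blow-down map. -/
def f (k : ℕ) (x : W k) : Fin 4 → ℂ := blowDown k x.1

/-- The exceptional curve `C_k = f_k⁻¹(0)`. -/
def C (k : ℕ) : Set (W k) := f k ⁻¹' {0}

/-- `B = {z ∈ Y_k ∩ ℝ⁴ ; z₄ > 0}`. -/
def B (k : ℕ) : Set (Fin 4 → ℂ) :=
  {z | z ∈ Y k ∧ (∀ i, (z i).im = 0) ∧ 0 < (z 3).re}

/-- `A = f_k⁻¹(B)`. -/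
def A (k : ℕ) : Set (W k) := f k ⁻¹' B k

/-! ### Affine coordinates on the projective line -/

/-- The affine coordinate `q / p` of `[p : q]`. -/
def coordZ (l : P1) : ℂ := l.rep 1 / l.rep 0

/-- The affine coordinate `p / q` of `[p : q]`. -/
def coordW (l : P1) : ℂ := l.rep 0 / l.rep 1

/-- The open set `p ≠ 0`. -/
def domZ : Set P1 := {l | l.rep 0 ≠ 0}

/-- The open set `q ≠ 0`. -/
def domW : Set P1 := {l | l.rep 1 ≠ 0}

lemma ne_zero_z (z : ℂ) : (![1, z] : Fin 2 → ℂ) ≠ 0 := fun h => by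
  simpa using congrFun h 0

lemma ne_zero_w (w : ℂ) : (![w, 1] : Fin 2 → ℂ) ≠ 0 := fun h => by
  simpa using congrFun h 1

/-- The point `[1 : z]`. -/
def ptZ (z : ℂ) : P1 := Projectivization.mk ℂ ![1, z] (ne_zero_z z)

/-- The point `[w : 1]`. -/
def ptW (w : ℂ) : P1 := Projectivization.mk ℂ ![w, 1] (ne_zero_w w)

lemma isQuotientMap_mk : IsQuotientMap
    (fun v : {v : Fin 2 → ℂ // v ≠ 0} => Projectivization.mk ℂ v.1 v.2) :=
  ⟨⟨rfl⟩, fun l => ⟨⟨l.rep, l.rep_nonzero⟩, l.mk_rep⟩⟩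

lemma rep_mk (v : Fin 2 → ℂ) (hv : v ≠ 0) :
    ∃ a : ℂ, a ≠ 0 ∧ (Projectivization.mk ℂ v hv).rep = a • v := by
  obtain ⟨a, ha⟩ := Projectivization.exists_smul_eq_mk_rep ℂ v hv
  exact ⟨a, a.ne_zero, ha.symm⟩

lemma mem_domZ_mk (v : Fin 2 → ℂ) (hv : v ≠ 0) :
    Projectivization.mk ℂ v hv ∈ domZ ↔ v 0 ≠ 0 := by
  obtain ⟨a, ha, h⟩ := rep_mk v hv
  simp [domZ, h, ha]

lemma mem_domW_mk (v : Fin 2 → ℂ) (hv : v ≠ 0) :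
    Projectivization.mk ℂ v hv ∈ domW ↔ v 1 ≠ 0 := by
  obtain ⟨a, ha, h⟩ := rep_mk v hv
  simp [domW, h, ha]

lemma coordZ_mk (v : Fin 2 → ℂ) (hv : v ≠ 0) :
    coordZ (Projectivization.mk ℂ v hv) = v 1 / v 0 := by
  obtain ⟨a, ha, h⟩ := rep_mk v hv
  simp [coordZ, h, mul_div_mul_left _ _ ha]

lemma coordW_mk (v : Fin 2 → ℂ) (hv : v ≠ 0) :
    coordW (Projectivization.mk ℂ v hv) = v 0 / v 1 := by
  obtain ⟨a, ha, h⟩ := rep_mk v hv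
  simp [coordW, h, mul_div_mul_left _ _ ha]

@[simp] lemma coordZ_ptZ (z : ℂ) : coordZ (ptZ z) = z := by simp [ptZ, coordZ_mk]
@[simp] lemma coordW_ptW (w : ℂ) : coordW (ptW w) = w := by simp [ptW, coordW_mk]
@[simp] lemma coordW_ptZ (z : ℂ) : coordW (ptZ z) = z⁻¹ := by simp [ptZ, coordW_mk]
@[simp] lemma coordZ_ptW (w : ℂ) : coordZ (ptW w) = w⁻¹ := by simp [ptW, coordZ_mk]
lemma ptZ_mem (z : ℂ) : ptZ z ∈ domZ := by simp [ptZ, mem_domZ_mk]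
lemma ptW_mem (w : ℂ) : ptW w ∈ domW := by simp [ptW, mem_domW_mk]
lemma ptZ_mem_domW (z : ℂ) : ptZ z ∈ domW ↔ z ≠ 0 := by simp [ptZ, mem_domW_mk]
lemma ptW_mem_domZ (w : ℂ) : ptW w ∈ domZ ↔ w ≠ 0 := by simp [ptW, mem_domZ_mk]

lemma ptZ_coordZ {l : P1} (hl : l ∈ domZ) : ptZ (coordZ l) = l := by
  conv_rhs => rw [← l.mk_rep]
  have h0 : l.rep 0 ≠ 0 := hl
  rw [ptZ, Projectivization.mk_eq_mk_iff']
  refine ⟨(l.rep 0)⁻¹, ?_⟩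
  ext i; fin_cases i
  · simp [h0]
  · simp [coordZ, div_eq_inv_mul]

lemma ptW_coordW {l : P1} (hl : l ∈ domW) : ptW (coordW l) = l := by
  conv_rhs => rw [← l.mk_rep]
  have h0 : l.rep 1 ≠ 0 := hl
  rw [ptW, Projectivization.mk_eq_mk_iff']
  refine ⟨(l.rep 1)⁻¹, ?_⟩
  ext i; fin_cases i
  · simp [coordW, div_eq_inv_mul]
  · simp [h0]

lemma domZ_or_domW (l : P1) : l ∈ domZ ∨ l ∈ domW := by
  by_contra h
  simp only [domZ, domW, mem_ofPred_eq, not_or, not_not] at h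
  apply l.rep_nonzero
  ext i; fin_cases i
  · exact h.1
  · exact h.2

lemma isOpen_domZ : IsOpen domZ := by
  rw [← isQuotientMap_mk.isOpen_preimage]
  have : (fun v : {v : Fin 2 → ℂ // v ≠ 0} => Projectivization.mk ℂ v.1 v.2) ⁻¹' domZ
      = {v | v.1 0 ≠ 0} := by ext v; exact mem_domZ_mk v.1 v.2
  rw [this]
  exact isOpen_ne_fun ((continuous_apply 0).comp continuous_subtype_val) continuous_const

lemma isOpen_domW : IsOpen domW := by
  rw [← isQuotientMap_mk.isOpen_preimage]
  have : (fun v : {v : Fin 2 → ℂ // v ≠ 0} => Projectivization.mk ℂ v.1 v.2) ⁻¹' domW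
      = {v | v.1 1 ≠ 0} := by ext v; exact mem_domW_mk v.1 v.2
  rw [this]
  exact isOpen_ne_fun ((continuous_apply 1).comp continuous_subtype_val) continuous_const

lemma continuousOn_coordZ : ContinuousOn coordZ domZ := by
  rw [isQuotientMap_mk.continuousOn_isOpen_iff isOpen_domZ]
  have : coordZ ∘ (fun v : {v : Fin 2 → ℂ // v ≠ 0} => Projectivization.mk ℂ v.1 v.2)
      = fun v => v.1 1 / v.1 0 := by ext v; exact coordZ_mk v.1 v.2
  rw [this]
  exact ContinuousOn.div
    ((continuous_apply _).comp continuous_subtype_val).continuousOn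
    ((continuous_apply _).comp continuous_subtype_val).continuousOn fun v hv => (mem_domZ_mk v.1 v.2).1 hv

lemma continuousOn_coordW : ContinuousOn coordW domW := by
  rw [isQuotientMap_mk.continuousOn_isOpen_iff isOpen_domW]
  have : coordW ∘ (fun v : {v : Fin 2 → ℂ // v ≠ 0} => Projectivization.mk ℂ v.1 v.2)
      = fun v => v.1 0 / v.1 1 := by ext v; exact coordW_mk v.1 v.2
  rw [this]
  exact ContinuousOn.div
    ((continuous_apply _).comp continuous_subtype_val).continuousOn
    ((continuous_apply _).comp continuous_subtype_val).continuousOn fun v hv => (mem_domW_mk v.1 v.2).1 hv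

lemma continuous_ptZ : Continuous ptZ := by
  have h : Continuous fun z : ℂ => (⟨![1, z], ne_zero_z z⟩ : {v : Fin 2 → ℂ // v ≠ 0}) := by
    refine Continuous.subtype_mk (continuous_pi fun i => ?_) _
    fin_cases i
    · exact continuous_const
    · exact continuous_id
  exact isQuotientMap_mk.continuous.comp h

lemma continuous_ptW : Continuous ptW := by
  have h : Continuous fun w : ℂ => (⟨![w, 1], ne_zero_w w⟩ : {v : Fin 2 → ℂ // v ≠ 0}) := by
    refine Continuous.subtype_mk (continuous_pi fun i => ?_) _
    fin_cases i
    · exact continuous_id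
    · exact continuous_const
  exact isQuotientMap_mk.continuous.comp h

lemma mem_ptZ (u : Fin 2 → ℂ) (z : ℂ) : u ∈ (ptZ z).submodule ↔ u 1 = z * u 0 := by
  rw [ptZ, Projectivization.submodule_mk, Submodule.mem_span_singleton]
  constructor
  · rintro ⟨c, rfl⟩; simp [mul_comm]
  · intro h
    refine ⟨u 0, ?_⟩
    ext i; fin_cases i
    · simp
    · simp [h, mul_comm]

lemma mem_ptW (u : Fin 2 → ℂ) (w : ℂ) : u ∈ (ptW w).submodule ↔ u 0 = w * u 1 := by
  rw [ptW, Projectivization.submodule_mk, Submodule.mem_span_singleton]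
  constructor
  · rintro ⟨c, rfl⟩; simp [mul_comm]
  · intro h
    refine ⟨u 1, ?_⟩
    ext i; fin_cases i
    · simp [h, mul_comm]
    · simp

lemma mem_iff_of_domZ (u : Fin 2 → ℂ) {l : P1} (hl : l ∈ domZ) :
    u ∈ l.submodule ↔ u 1 = coordZ l * u 0 := by
  conv_lhs => rw [← ptZ_coordZ hl]
  exact mem_ptZ u _

lemma mem_iff_of_domW (u : Fin 2 → ℂ) {l : P1} (hl : l ∈ domW) :
    u ∈ l.submodule ↔ u 0 = coordW l * u 1 := by
  conv_lhs => rw [← ptW_coordW hl]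
  exact mem_ptW u _

/-- The incidence relation is closed. -/
lemma isClosed_incidence : IsClosed {x : (Fin 2 → ℂ) × P1 | x.1 ∈ x.2.submodule} := by
  have hZ : IsOpen ((Prod.snd ⁻¹' domZ : Set ((Fin 2 → ℂ) × P1)) ∩
      (fun x => x.1 1 - coordZ x.2 * x.1 0) ⁻¹' {0}ᶜ) := by
    refine ContinuousOn.isOpen_inter_preimage ?_ (isOpen_domZ.preimage continuous_snd)
      isOpen_compl_singleton
    have h := continuousOn_coordZ.comp (continuous_snd (X := Fin 2 → ℂ)).continuousOn
      (mapsTo_preimage _ _)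
    exact ContinuousOn.sub (by fun_prop) (h.mul (by fun_prop))
  have hW : IsOpen ((Prod.snd ⁻¹' domW : Set ((Fin 2 → ℂ) × P1)) ∩
      (fun x => x.1 0 - coordW x.2 * x.1 1) ⁻¹' {0}ᶜ) := by
    refine ContinuousOn.isOpen_inter_preimage ?_ (isOpen_domW.preimage continuous_snd)
      isOpen_compl_singleton
    have h := continuousOn_coordW.comp (continuous_snd (X := Fin 2 → ℂ)).continuousOn
      (mapsTo_preimage _ _)
    exact ContinuousOn.sub (by fun_prop) (h.mul (by fun_prop))
  rw [← isOpen_compl_iff]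
  convert hZ.union hW using 1
  ext ⟨u, l⟩
  simp only [mem_compl_iff, mem_ofPred_eq, mem_union, mem_inter_iff, mem_preimage,
    mem_singleton_iff, sub_eq_zero]
  constructor
  · intro h
    rcases domZ_or_domW l with hl | hl
    · exact Or.inl ⟨hl, by rwa [← mem_iff_of_domZ u hl]⟩
    · exact Or.inr ⟨hl, by rwa [← mem_iff_of_domW u hl]⟩
  · rintro (⟨hl, h⟩ | ⟨hl, h⟩)
    · rwa [mem_iff_of_domZ u hl]
    · rwa [mem_iff_of_domW u hl]

/-! ### The second equation of the strict transform -/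

/-- `(z₃ + z₄^k, -(z₁ + i z₂))`, which on `Y_k` is proportional to
`(z₁ - i z₂, z₃ - z₄^k)`. -/
def dualEq (k : ℕ) (z : Fin 4 → ℂ) : Fin 2 → ℂ :=
  ![z 2 + z 3 ^ k, -(z 0 + I * z 1)]

lemma dualEq_mem {k : ℕ} (x : W k) : dualEq k x.1.1.1 ∈ x.1.1.2.submodule := by
  have hcl : IsClosed {y : blowUp k | dualEq k y.1.1 ∈ y.1.2.submodule} := by
    have hc : Continuous fun y : blowUp k => ((dualEq k y.1.1, y.1.2) : (Fin 2 → ℂ) × P1) := by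
      refine Continuous.prodMk (continuous_pi fun i => ?_) (by fun_prop)
      fin_cases i
      · simp only [dualEq]; dsimp; fun_prop
      · simp only [dualEq]; dsimp; fun_prop
    exact isClosed_incidence.preimage hc
  refine closure_minimal ?_ hcl x.2
  rintro ⟨⟨z, l⟩, hzl⟩ ⟨hY, hS⟩
  simp only [blowDown, Y, S, mem_ofPred_eq, blowUp] at hY hS hzl ⊢
  have key : (z 0 - I * z 1) * (z 0 + I * z 1) = -((z 2 - z 3 ^ k) * (z 2 + z 3 ^ k)) := by
    have h2 : z 3 ^ (2 * k) = z 3 ^ k * z 3 ^ k := by rw [two_mul, pow_add]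
    rw [h2] at hY
    linear_combination hY - z 1 ^ 2 * I_sq
  change dualEq k z ∈ l.submodule
  rcases domZ_or_domW l with hl | hl
  · rw [mem_iff_of_domZ _ hl] at hzl ⊢
    simp only [centerEq, dualEq, Matrix.cons_val_zero, Matrix.cons_val_one] at hzl ⊢
    have ha : z 0 - I * z 1 ≠ 0 := fun h => hS ⟨h, by rw [hzl, h, mul_zero]⟩
    apply mul_left_cancel₀ ha
    linear_combination -key + (z 2 + z 3 ^ k) * hzl
  · rw [mem_iff_of_domW _ hl] at hzl ⊢
    simp only [centerEq, dualEq, Matrix.cons_val_zero, Matrix.cons_val_one] at hzl ⊢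
    have hc : z 2 - z 3 ^ k ≠ 0 := fun h => hS ⟨by rw [hzl, h, mul_zero], h⟩
    apply mul_left_cancel₀ hc
    linear_combination key - (z 0 + I * z 1) * hzl

lemma centerEq_mem {k : ℕ} (x : W k) : centerEq k x.1.1.1 ∈ x.1.1.2.submodule := x.1.2

/-- `f_k` maps `W_k` into `Y_k`. -/
lemma f_mem_Y {k : ℕ} (x : W k) : f k x ∈ Y k := by
  have hcl : IsClosed {y : blowUp k | blowDown k y ∈ Y k} := by
    have hc : Continuous (blowDown k) := by unfold blowDown; fun_prop
    have : IsClosed (Y k) := isClosed_eq (by fun_prop) continuous_const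
    exact this.preimage hc
  exact closure_minimal (fun y hy => hy.1) hcl x.2

/-! ### The two charts of `W_k` -/

/-- The point of `ℂ⁴` with coordinates `(z, x₁, x₂)`. -/
def vecZ (k : ℕ) (p : ℂ × ℂ × ℂ) : Fin 4 → ℂ :=
  ![p.2.1 - (p.1 ^ 2 * p.2.1 + p.1 * p.2.2 ^ k), I * (p.2.1 + (p.1 ^ 2 * p.2.1 + p.1 * p.2.2 ^ k)),
    2 * p.1 * p.2.1 + p.2.2 ^ k, p.2.2]

/-- The point of `ℂ⁴` with coordinates `(w, y₁, y₂)`. -/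
def vecW (k : ℕ) (p : ℂ × ℂ × ℂ) : Fin 4 → ℂ :=
  ![(p.1 ^ 2 * p.2.1 - p.1 * p.2.2 ^ k) - p.2.1, I * ((p.1 ^ 2 * p.2.1 - p.1 * p.2.2 ^ k) + p.2.1),
    2 * p.1 * p.2.1 - p.2.2 ^ k, p.2.2]

lemma centerEq_vecZ (k : ℕ) (p : ℂ × ℂ × ℂ) :
    centerEq k (vecZ k p) = ![2 * p.2.1, 2 * p.1 * p.2.1] := by
  ext i; fin_cases i
  · simp [centerEq, vecZ, ← mul_assoc]; ring
  · simp [centerEq, vecZ]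

lemma centerEq_vecW (k : ℕ) (p : ℂ × ℂ × ℂ) :
    centerEq k (vecW k p) =
      ![p.1 * (2 * (p.1 * p.2.1 - p.2.2 ^ k)), 2 * (p.1 * p.2.1 - p.2.2 ^ k)] := by
  ext i; fin_cases i
  · simp [centerEq, vecW, ← mul_assoc]; ring
  · simp [centerEq, vecW]; ring

lemma vecZ_mem_Y (k : ℕ) (p : ℂ × ℂ × ℂ) : vecZ k p ∈ Y k := by
  simp [Y, vecZ, mul_pow, two_mul, pow_add]; ring

lemma vecW_mem_Y (k : ℕ) (p : ℂ × ℂ × ℂ) : vecW k p ∈ Y k := by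
  simp [Y, vecW, mul_pow, two_mul, pow_add]; ring

lemma mem_S_iff (k : ℕ) (z : Fin 4 → ℂ) : z ∈ S k ↔ centerEq k z = 0 := by
  constructor
  · rintro ⟨h1, h2⟩
    ext i; fin_cases i
    · exact h1
    · exact h2
  · intro h
    exact ⟨congrFun h 0, congrFun h 1⟩

/-- The point of `N_k` with coordinates `(z, x₁, x₂)`. -/
def invZN (k : ℕ) (p : ℂ × ℂ × ℂ) : blowUp k :=
  ⟨(vecZ k p, ptZ p.1), by
    simp only [blowUp, mem_ofPred_eq, mem_ptZ, centerEq_vecZ]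
    simp; ring⟩

/-- The point of `N_k` with coordinates `(w, y₁, y₂)`. -/
def invWN (k : ℕ) (p : ℂ × ℂ × ℂ) : blowUp k :=
  ⟨(vecW k p, ptW p.1), by
    simp only [blowUp, mem_ofPred_eq, mem_ptW, centerEq_vecW]
    simp⟩

lemma continuous_vecZ (k : ℕ) : Continuous (vecZ k) := by
  refine continuous_pi fun i => ?_
  fin_cases i <;> simp only [vecZ] <;> dsimp <;> fun_prop

lemma continuous_vecW (k : ℕ) : Continuous (vecW k) := by
  refine continuous_pi fun i => ?_
  fin_cases i <;> simp only [vecW] <;> dsimp <;> fun_prop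

lemma continuous_invZN (k : ℕ) : Continuous (invZN k) :=
  ((continuous_vecZ k).prodMk (continuous_ptZ.comp continuous_fst)).subtype_mk _

lemma continuous_invWN (k : ℕ) : Continuous (invWN k) :=
  ((continuous_vecW k).prodMk (continuous_ptW.comp continuous_fst)).subtype_mk _

lemma invZN_mem (k : ℕ) (p : ℂ × ℂ × ℂ) : invZN k p ∈ strictTransform k := by
  have hd : ∀ᶠ s in 𝓝[≠] p.2.1, s ≠ 0 := by
    rcases eq_or_ne p.2.1 0 with h | h
    · rw [h]; exact self_mem_nhdsWithin
    · exact nhdsWithin_le_nhds (isOpen_ne.mem_nhds h)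
  have hc : Continuous fun s : ℂ => invZN k (p.1, s, p.2.2) :=
    (continuous_invZN k).comp (by fun_prop)
  refine mem_closure_of_tendsto ((hc.tendsto p.2.1).mono_left nhdsWithin_le_nhds)
    (hd.mono fun s hs => ⟨vecZ_mem_Y k _, fun h => ?_⟩)
  have h0 := congrFun ((mem_S_iff k _).1 h) 0
  simp only [blowDown, invZN, centerEq_vecZ] at h0
  simp [hs] at h0

lemma invWN_mem (k : ℕ) (p : ℂ × ℂ × ℂ) : invWN k p ∈ strictTransform k := by
  by_cases hw : p.1 = 0
  · have hd : ∀ᶠ s in 𝓝[≠] p.2.2, s ≠ 0 := by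
      rcases eq_or_ne p.2.2 0 with h | h
      · rw [h]; exact self_mem_nhdsWithin
      · exact nhdsWithin_le_nhds (isOpen_ne.mem_nhds h)
    have hc : Continuous fun s : ℂ => invWN k (p.1, p.2.1, s) :=
      (continuous_invWN k).comp (by fun_prop)
    refine mem_closure_of_tendsto ((hc.tendsto p.2.2).mono_left nhdsWithin_le_nhds)
      (hd.mono fun s hs => ⟨vecW_mem_Y k _, fun h => ?_⟩)
    have h0 := congrFun ((mem_S_iff k _).1 h) 1
    simp only [blowDown, invWN, centerEq_vecW] at h0
    simp [hw, hs] at h0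
  · have hd : ∀ᶠ s in 𝓝[≠] p.2.1, s ≠ p.2.2 ^ k / p.1 := by
      rcases eq_or_ne p.2.1 (p.2.2 ^ k / p.1) with h | h
      · rw [← h]; exact self_mem_nhdsWithin
      · exact nhdsWithin_le_nhds (isOpen_ne.mem_nhds h)
    have hc : Continuous fun s : ℂ => invWN k (p.1, s, p.2.2) :=
      (continuous_invWN k).comp (by fun_prop)
    refine mem_closure_of_tendsto ((hc.tendsto p.2.1).mono_left nhdsWithin_le_nhds)
      (hd.mono fun s hs => ⟨vecW_mem_Y k _, fun h => hs ?_⟩)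
    have h0 := congrFun ((mem_S_iff k _).1 h) 1
    simp only [blowDown, invWN, centerEq_vecW] at h0
    simp [sub_eq_zero] at h0
    rw [eq_div_iff hw, mul_comm]; exact h0

/-- The chart `(z, x₁, x₂)` of `W_k`: on the open set `p ≠ 0`, where `ℓ = [p : q]`,
`z = q / p`, `x₁ = (z₁ - i z₂) / 2`, `x₂ = z₄`. -/
def chartZ (k : ℕ) : OpenPartialHomeomorph (W k) (ℂ × ℂ × ℂ) where
  toFun x := (coordZ x.1.1.2, (x.1.1.1 0 - I * x.1.1.1 1) / 2, x.1.1.1 3)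
  invFun p := ⟨invZN k p, invZN_mem k p⟩
  source := {x | x.1.1.2 ∈ domZ}
  target := univ
  map_source' _ _ := mem_univ _
  map_target' p _ := ptZ_mem p.1
  left_inv' := by
    rintro x hx
    have h1 := (mem_iff_of_domZ _ hx).1 (centerEq_mem x)
    have h2 := (mem_iff_of_domZ _ hx).1 (dualEq_mem x)
    simp only [centerEq, dualEq, Matrix.cons_val_zero, Matrix.cons_val_one] at h1 h2
    apply Subtype.ext
    apply Subtype.ext
    refine Prod.ext ?_ (ptZ_coordZ hx)
    ext i
    fin_cases i
    · simp [invZN, vecZ]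
      linear_combination (coordZ x.1.1.2) / 2 * h1 + h2 / 2
    · simp [invZN, vecZ]
      linear_combination -I * (coordZ x.1.1.2) / 2 * h1 - I / 2 * h2 - x.1.1.1 1 * I_sq
    · simp [invZN, vecZ]
      linear_combination -h1
    · simp [invZN, vecZ]
  right_inv' := by
    rintro ⟨z, x1, x2⟩ -
    simp [invZN, vecZ, ← mul_assoc]
    ring
  open_source := isOpen_domZ.preimage (by fun_prop)
  open_target := isOpen_univ
  continuousOn_toFun := by
    have h : ContinuousOn (fun x : W k => coordZ x.1.1.2) {x | x.1.1.2 ∈ domZ} :=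
      continuousOn_coordZ.comp (by fun_prop) (fun x hx => hx)
    exact h.prodMk (by fun_prop)
  continuousOn_invFun := ((continuous_invZN k).subtype_mk _).continuousOn

/-- The chart `(w, y₁, y₂)` of `W_k`: on the open set `q ≠ 0`, where `ℓ = [p : q]`,
`w = p / q`, `y₁ = -(z₁ + i z₂) / 2`, `y₂ = z₄`. -/
def chartW (k : ℕ) : OpenPartialHomeomorph (W k) (ℂ × ℂ × ℂ) where
  toFun x := (coordW x.1.1.2, -(x.1.1.1 0 + I * x.1.1.1 1) / 2, x.1.1.1 3)
  invFun p := ⟨invWN k p, invWN_mem k p⟩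
  source := {x | x.1.1.2 ∈ domW}
  target := univ
  map_source' _ _ := mem_univ _
  map_target' p _ := ptW_mem p.1
  left_inv' := by
    rintro x hx
    have h1 := (mem_iff_of_domW _ hx).1 (centerEq_mem x)
    have h2 := (mem_iff_of_domW _ hx).1 (dualEq_mem x)
    simp only [centerEq, dualEq, Matrix.cons_val_zero, Matrix.cons_val_one] at h1 h2
    apply Subtype.ext
    apply Subtype.ext
    refine Prod.ext ?_ (ptW_coordW hx)
    ext i
    fin_cases i
    · simp [invWN, vecW]
      linear_combination -h1 / 2 - (coordW x.1.1.2) / 2 * h2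
    · simp [invWN, vecW]
      linear_combination -I * (coordW x.1.1.2) / 2 * h2 - I / 2 * h1 - x.1.1.1 1 * I_sq
    · simp [invWN, vecW]
      linear_combination -h2
    · simp [invWN, vecW]
  right_inv' := by
    rintro ⟨z, x1, x2⟩ -
    simp [invWN, vecW, ← mul_assoc]
    ring
  open_source := isOpen_domW.preimage (by fun_prop)
  open_target := isOpen_univ
  continuousOn_toFun := by
    have h : ContinuousOn (fun x : W k => coordW x.1.1.2) {x | x.1.1.2 ∈ domW} :=
      continuousOn_coordW.comp (by fun_prop) (fun x hx => hx)
    exact h.prodMk (by fun_prop)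
  continuousOn_invFun := ((continuous_invWN k).subtype_mk _).continuousOn

/-- The coordinate change: `w = 1 / z`, `y₁ = z² x₁ + z x₂^k`, `y₂ = x₂`. -/
lemma chartW_chartZ_symm (k : ℕ) (p : ℂ × ℂ × ℂ) :
    chartW k ((chartZ k).symm p) =
      (p.1⁻¹, p.1 ^ 2 * p.2.1 + p.1 * p.2.2 ^ k, p.2.2) := by
  obtain ⟨z, x1, x2⟩ := p
  simp [chartW, chartZ, invZN, vecZ, ← mul_assoc]
  ring

/-- The inverse coordinate change. -/
lemma chartZ_chartW_symm (k : ℕ) (p : ℂ × ℂ × ℂ) :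
    chartZ k ((chartW k).symm p) =
      (p.1⁻¹, p.1 ^ 2 * p.2.1 - p.1 * p.2.2 ^ k, p.2.2) := by
  obtain ⟨z, x1, x2⟩ := p
  simp [chartW, chartZ, invWN, vecW, ← mul_assoc]
  ring

open Classical in
/-- The complex structure of `W_k`: the atlas consisting of the two charts. -/
instance (k : ℕ) : ChartedSpace (ℂ × ℂ × ℂ) (W k) where
  atlas := {chartZ k, chartW k}
  chartAt x := if x.1.1.2 ∈ domZ then chartZ k else chartW k
  mem_chart_source x := by
    by_cases hx : x.1.1.2 ∈ domZ
    · simp only [hx, if_true]; exact hx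
    · simp only [hx, if_false]; exact (domZ_or_domW _).resolve_left hx
  chart_mem_atlas x := by
    by_cases hx : x.1.1.2 ∈ domZ <;> simp [hx]

lemma atlas_eq (k : ℕ) : atlas (ℂ × ℂ × ℂ) (W k) = {chartZ k, chartW k} := rfl

/-- `W_k` is a complex manifold of dimension three. -/
instance (k : ℕ) : IsManifold 𝓘(ℂ, ℂ × ℂ × ℂ) ω (W k) := by
  refine isManifold_of_contDiffOn _ _ _ fun e e' he he' => ?_
  rw [atlas_eq] at he he'
  rcases he with rfl | rfl <;> rcases he' with rfl | rfl
  · exact contDiffOn_id.congr fun p hp => (chartZ k).right_inv (mem_univ p)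
  · refine ContDiffOn.congr (f := fun p : ℂ × ℂ × ℂ =>
      (p.1⁻¹, p.1 ^ 2 * p.2.1 + p.1 * p.2.2 ^ k, p.2.2)) ?_
      (fun p hp => chartW_chartZ_symm k p)
    refine ContDiffOn.prodMk (ContDiffOn.inv contDiff_fst.contDiffOn fun p hp => ?_)
      (by fun_prop)
    exact (ptZ_mem_domW p.1).1 hp.1.2
  · refine ContDiffOn.congr (f := fun p : ℂ × ℂ × ℂ =>
      (p.1⁻¹, p.1 ^ 2 * p.2.1 - p.1 * p.2.2 ^ k, p.2.2)) ?_
      (fun p hp => chartZ_chartW_symm k p)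
    refine ContDiffOn.prodMk (ContDiffOn.inv contDiff_fst.contDiffOn fun p hp => ?_)
      (by fun_prop)
    exact (ptW_mem_domZ p.1).1 hp.1.2
  · exact contDiffOn_id.congr fun p hp => (chartW k).right_inv (mem_univ p)

/-- `W_k` as a real smooth manifold of dimension six, with the same charts. -/
instance (k : ℕ) : IsManifold 𝓘(ℝ, ℂ × ℂ × ℂ) ∞ (W k) := by
  refine isManifold_of_contDiffOn _ _ _ fun e e' he he' => ?_
  have h : e.symm ≫ₕ e' ∈ contDiffGroupoid ω 𝓘(ℂ, ℂ × ℂ × ℂ) :=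
    (contDiffGroupoid ω 𝓘(ℂ, ℂ × ℂ × ℂ)).compatible he he'
  have h1 := ((contDiffGroupoid ω 𝓘(ℂ, ℂ × ℂ × ℂ)).mem_iff_of_eqOnSource
    (OpenPartialHomeomorph.eqOnSource_refl _)).1 h
  rw [contDiffGroupoid, mem_groupoid_of_pregroupoid] at h1
  have h2 : ContDiffOn ℂ ω (e.symm ≫ₕ e') (e.symm ≫ₕ e').source := by
    simpa [contDiffPregroupoid] using h1.1
  have h3 : ContDiffOn ℝ ∞ (e.symm ≫ₕ e') (e.symm ≫ₕ e').source :=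
    (h2.restrict_scalars ℝ).of_le le_top
  simpa using h3

end OneConvex

end

/-!
The closure of `A` is described explicitly in the two charts of `W_k`, where it turns out to be a
graph over a half-space.

A real point of `Y_k` with `z₄ = t` lies on the sphere `z₁² + z₂² + z₃² = t^{2k}`, and the
coordinate `ζ = q / p` is a stereographic coordinate on that sphere. Solving for `x₁` gives
`x₁ = -t^k ζ̄ / (1 + |ζ|²)` (`real_iff_eq_stereographic`), a formula that remains smooth at `t = 0`,
where it describes the exceptional curve `x₁ = x₂ = 0`. Thus in the chart `(ζ, x₁, x₂)` the preimage
of the real points with `z₄ ≥ 0` is the graph of a smooth function of `(ζ, t)` over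
`ℂ × [0, ∞)`; in the chart `(w, y₁, y₂)` the same holds with the opposite sign. Moving along the
graph in the direction of increasing `t` shows that this preimage is the closure of `A`
(`closure_A`), and it equals `A ∪ C` because a real point of `Y_k` with `z₄ = 0` is the origin
(`A_union_C`); this uses `k ≥ 1`.

Subtracting the function from `x₁` is a diffeomorphism of `ℂ³`, which turns the two charts into
charts of `W_k`, as a real manifold, in which the closure of `A` is a closed half-space of dimension
three. A subset covered by such charts is a smoothly embedded manifold with boundary
(`HalfSlice.exists_manifold_structure`), with boundary where `z₄ = 0`.
-/

/-! ### Subsets that are locally half-space slices -/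

noncomputable section

namespace HalfSlice

open Set Topology

variable {n : ℕ} [NeZero n] {F E M : Type*}
  [NormedAddCommGroup F] [NormedSpace ℝ F] [NormedAddCommGroup E] [NormedSpace ℝ E]
  [TopologicalSpace M]

/-- A chart `ψ` of `M` with values in `E` is a *half-space slice chart* for the subset `S`, with
respect to a linear splitting `E ≃ ℝⁿ × F`, if it is onto `E` and if in it `S` becomes the
half-space `{0 ≤ v 0} × {0}`. Asking for `ψ` to be onto `E` keeps the induced chart of `S`
defined everywhere on the half-space. -/
structure IsSliceChart (L : (EuclideanSpace ℝ (Fin n) × F) ≃L[ℝ] E) (S : Set M)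
    (ψ : OpenPartialHomeomorph M E) : Prop where
  target_eq : ψ.target = univ
  mem_iff : ∀ p, ψ.symm (L p) ∈ S ↔ 0 ≤ p.1 0 ∧ p.2 = 0

namespace IsSliceChart

variable {L : (EuclideanSpace ℝ (Fin n) × F) ≃L[ℝ] E} {S : Set M}
  {ψ ψ' : OpenPartialHomeomorph M E}

lemma apply_mem (h : IsSliceChart L S ψ) {x : M} (hx : x ∈ ψ.source) (hS : x ∈ S) :
    0 ≤ (L.symm (ψ x)).1 0 ∧ (L.symm (ψ x)).2 = 0 := by
  rw [← h.mem_iff, L.apply_symm_apply, ψ.left_inv hx]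
  exact hS

lemma model_symm_apply (h : IsSliceChart L S ψ) {x : M} (hx : x ∈ ψ.source) (hS : x ∈ S) :
    ((𝓡∂ n).symm (L.symm (ψ x)).1).1 = (L.symm (ψ x)).1 := by
  refine (𝓡∂ n).right_inv ?_
  rw [range_modelWithCornersEuclideanHalfSpace]
  exact (h.apply_mem hx hS).1

/-- The chart of `S` with values in the half-space induced by a slice chart. -/
def chart (h : IsSliceChart L S ψ) : OpenPartialHomeomorph S (EuclideanHalfSpace n) where
  -- `(𝓡∂ n).symm` retracts onto the half-space; on the source it changes nothing.
  toFun x := (𝓡∂ n).symm (L.symm (ψ x)).1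
  invFun v := ⟨ψ.symm (L (v.1, 0)), (h.mem_iff _).2 ⟨v.2, rfl⟩⟩
  source := Subtype.val ⁻¹' ψ.source
  target := univ
  map_source' _ _ := mem_univ _
  map_target' v _ := ψ.map_target (h.target_eq ▸ mem_univ _)
  left_inv' := by
    rintro ⟨x, hS⟩ (hx : x ∈ ψ.source)
    refine Subtype.ext ?_
    change ψ.symm (L (((𝓡∂ n).symm (L.symm (ψ x)).1).1, 0)) = x
    rw [h.model_symm_apply hx hS, ← (h.apply_mem hx hS).2, Prod.mk.eta, L.apply_symm_apply,
      ψ.left_inv hx]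
  right_inv' := by
    rintro v -
    change (𝓡∂ n).symm (L.symm (ψ (ψ.symm (L (v.1, 0))))).1 = v
    rw [ψ.right_inv (h.target_eq ▸ mem_univ _), L.symm_apply_apply]
    exact (𝓡∂ n).left_inv v
  open_source := ψ.open_source.preimage continuous_subtype_val
  open_target := isOpen_univ
  continuousOn_toFun := by
    refine (𝓡∂ n).continuous_symm.comp_continuousOn (continuous_fst.comp_continuousOn
      (L.symm.continuous.comp_continuousOn
        (ψ.continuousOn.comp continuous_subtype_val.continuousOn (mapsTo_preimage _ _))))
  continuousOn_invFun := by
    have hψ : Continuous ψ.symm := by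
      rw [← continuousOn_univ, ← h.target_eq]
      exact ψ.continuousOn_symm
    refine Continuous.continuousOn (Continuous.subtype_mk (hψ.comp (L.continuous.comp ?_)) _)
    exact continuous_subtype_val.prodMk continuous_const

lemma chart_apply (h : IsSliceChart L S ψ) (x : S) (hx : x.1 ∈ ψ.source) :
    (𝓡∂ n) (h.chart x) = (L.symm (ψ x)).1 :=
  h.model_symm_apply hx x.2

lemma chart_symm_model_symm (h : IsSliceChart L S ψ) {y : EuclideanSpace ℝ (Fin n)}
    (hy : y ∈ range (𝓡∂ n)) :
    (h.chart.symm ((𝓡∂ n).symm y)).1 = ψ.symm (L (y, 0)) := by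
  change ψ.symm (L (((𝓡∂ n).symm y).1, 0)) = _
  congr 3
  exact (𝓡∂ n).right_inv hy

/-- Induced charts of `S` inherit smooth coordinate changes from the ambient charts. -/
lemma contDiffOn_coordChange [ChartedSpace E M] [IsManifold 𝓘(ℝ, E) ∞ M]
    (h : IsSliceChart L S ψ) (h' : IsSliceChart L S ψ')
    (hψ : ψ ∈ IsManifold.maximalAtlas 𝓘(ℝ, E) ∞ M)
    (hψ' : ψ' ∈ IsManifold.maximalAtlas 𝓘(ℝ, E) ∞ M) :
    ContDiffOn ℝ ∞ ((𝓡∂ n) ∘ h.chart.symm ≫ₕ h'.chart ∘ (𝓡∂ n).symm)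
      ((𝓡∂ n).symm ⁻¹' (h.chart.symm ≫ₕ h'.chart).source ∩ range (𝓡∂ n)) := by
  have hc : ContDiffOn ℝ ∞ (ψ.symm ≫ₕ ψ') (ψ.symm ≫ₕ ψ').source := by
    have := IsManifold.compatible_of_mem_maximalAtlas hψ hψ'
    rw [contDiffGroupoid, mem_groupoid_of_pregroupoid] at this
    simpa [contDiffPregroupoid] using this.1
  have key : ∀ y ∈ (𝓡∂ n).symm ⁻¹' (h.chart.symm ≫ₕ h'.chart).source ∩ range (𝓡∂ n),
      L (y, 0) ∈ (ψ.symm ≫ₕ ψ').source ∧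
      (h.chart.symm ((𝓡∂ n).symm y)).1 = ψ.symm (L (y, 0)) := by
    rintro y ⟨hy, hyr⟩
    have he := h.chart_symm_model_symm hyr
    refine ⟨⟨h.target_eq ▸ mem_univ _, ?_⟩, he⟩
    have : (h.chart.symm ((𝓡∂ n).symm y)).1 ∈ ψ'.source := hy.2
    rwa [he] at this
  have hL : ContDiff ℝ ∞ fun y : EuclideanSpace ℝ (Fin n) => L (y, (0 : F)) :=
    L.contDiff.comp (contDiff_id.prodMk contDiff_const)
  have hL' : ContDiff ℝ ∞ fun z : E => (L.symm z).1 := contDiff_fst.comp L.symm.contDiff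
  refine (hL'.comp_contDiffOn (hc.comp hL.contDiffOn fun y hy => (key y hy).1)).congr ?_
  intro y hy
  have hs : (h.chart.symm ((𝓡∂ n).symm y)).1 ∈ ψ'.source := hy.1.2
  refine (h'.chart_apply _ hs).trans ?_
  rw [(key y hy).2]
  rfl

end IsSliceChart

variable [ChartedSpace E M] [IsManifold 𝓘(ℝ, E) ∞ M]

/-- A subset covered by half-space slice charts is a smoothly embedded submanifold with boundary,
and its interior points are those at which the first slice coordinate is positive. -/
theorem exists_manifold_structure {ι : Type*} (L : (EuclideanSpace ℝ (Fin n) × F) ≃L[ℝ] E)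
    (S : Set M) (ψ : ι → OpenPartialHomeomorph M E)
    (hψ : ∀ i, ψ i ∈ IsManifold.maximalAtlas 𝓘(ℝ, E) ∞ M)
    (hS : ∀ i, IsSliceChart L S (ψ i)) (hcov : ∀ x ∈ S, ∃ i, x ∈ (ψ i).source) :
    ∃ _ : ChartedSpace (EuclideanHalfSpace n) S,
      IsManifold (𝓡∂ n) ∞ S ∧
      Manifold.IsSmoothEmbedding (𝓡∂ n) 𝓘(ℝ, E) ∞ (Subtype.val : S → M) ∧
      ∀ x : S, ∃ i, x.1 ∈ (ψ i).source ∧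
        ((𝓡∂ n).IsInteriorPoint x ↔ 0 < (L.symm (ψ i x)).1 0) := by
  choose i hi using fun x : S => hcov x.1 x.2
  let cs : ChartedSpace (EuclideanHalfSpace n) S :=
    { atlas := range fun j => (hS j).chart
      chartAt x := (hS (i x)).chart
      mem_chart_source x := hi x
      chart_mem_atlas x := mem_range_self _ }
  have hm : IsManifold (𝓡∂ n) ∞ S := by
    refine isManifold_of_contDiffOn _ _ _ ?_
    rintro _ _ ⟨j, rfl⟩ ⟨j', rfl⟩
    exact (hS j).contDiffOn_coordChange (hS j') (hψ j) (hψ j')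
  refine ⟨cs, hm, ⟨Manifold.IsImmersionOfComplement.isImmersion (F := F) fun x => ?_,
    IsEmbedding.subtypeVal⟩, fun x => ⟨i x, hi x, ?_⟩⟩
  · refine Manifold.IsImmersionAtOfComplement.mk_of_charts L (hS (i x)).chart (ψ (i x))
      (hi x) (hi x) (IsManifold.subset_maximalAtlas (mem_range_self _)) (hψ _)
      Subset.rfl ?_
    intro y hy
    have hyr : y ∈ range (𝓡∂ n) :=
      (OpenPartialHomeomorph.extend_target_subset_range _) hy
    change ψ (i x) ((hS (i x)).chart.symm ((𝓡∂ n).symm y)).1 = L (y, 0)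
    rw [(hS (i x)).chart_symm_model_symm hyr,
      (ψ (i x)).right_inv ((hS (i x)).target_eq ▸ mem_univ _)]
  · change (𝓡∂ n) ((hS (i x)).chart x) ∈ interior (range (𝓡∂ n)) ↔ _
    rw [interior_range_modelWithCornersEuclideanHalfSpace, (hS (i x)).chart_apply x (hi x)]
    rfl

end HalfSlice

end

/-! ### Flattening a graph -/

noncomputable section

namespace OneConvex

open Set Topology

/-- The splitting `ℂ³ ≃ ℝ³ × (ℂ × ℝ)` sending `(ζ, a, b)` to `((Re b, Re ζ, Im ζ), (a, Im b))`. -/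
def splitting : (EuclideanSpace ℝ (Fin 3) × (ℂ × ℝ)) ≃L[ℝ] ℂ × ℂ × ℂ :=
  LinearEquiv.toContinuousLinearEquiv
    { toFun := fun p => (⟨p.1 1, p.1 2⟩, p.2.1, ⟨p.1 0, p.2.2⟩)
      invFun := fun q => (!₂[q.2.2.re, q.1.re, q.1.im], (q.2.1, q.2.2.im))
      map_add' := fun _ _ => rfl
      map_smul' := fun r p => by ext <;> simp [Complex.ext_iff]
      left_inv := fun p => by
        refine Prod.ext ?_ rfl
        ext i
        fin_cases i <;> rfl
      right_inv := fun q => rfl }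

lemma splitting_apply (p : EuclideanSpace ℝ (Fin 3) × (ℂ × ℝ)) :
    splitting p = (⟨p.1 1, p.1 2⟩, p.2.1, ⟨p.1 0, p.2.2⟩) := rfl

lemma splitting_symm_zero (q : ℂ × ℂ × ℂ) : (splitting.symm q).1 0 = q.2.2.re := rfl

/-- The shear `(ζ, a, b) ↦ (ζ, a - g (ζ, b), b)`, which flattens the graph of `g`. -/
def shear (g : ℂ × ℂ → ℂ) (hg : Continuous g) : (ℂ × ℂ × ℂ) ≃ₜ (ℂ × ℂ × ℂ) where
  toFun p := (p.1, p.2.1 - g (p.1, p.2.2), p.2.2)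
  invFun p := (p.1, p.2.1 + g (p.1, p.2.2), p.2.2)
  left_inv p := by simp
  right_inv p := by simp
  continuous_toFun := by fun_prop
  continuous_invFun := by fun_prop

lemma shear_mem_contDiffGroupoid {g : ℂ × ℂ → ℂ} (hg : ContDiff ℝ ∞ g) :
    (shear g hg.continuous).toOpenPartialHomeomorph ∈ contDiffGroupoid ∞ 𝓘(ℝ, ℂ × ℂ × ℂ) := by
  have hg' : ContDiff ℝ ∞ fun p : ℂ × ℂ × ℂ => g (p.1, p.2.2) := hg.comp (by fun_prop)
  rw [contDiffGroupoid, mem_groupoid_of_pregroupoid]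
  constructor
  · have : ContDiff ℝ ∞ fun p : ℂ × ℂ × ℂ => (p.1, p.2.1 - g (p.1, p.2.2), p.2.2) := by fun_prop
    exact this.contDiffOn
  · have : ContDiff ℝ ∞ fun p : ℂ × ℂ × ℂ => (p.1, p.2.1 + g (p.1, p.2.2), p.2.2) := by fun_prop
    exact this.contDiffOn

lemma _root_.StructureGroupoid.trans_mem_maximalAtlas {H M : Type*} [TopologicalSpace H]
    [TopologicalSpace M] [ChartedSpace H M] {G : StructureGroupoid H}
    {c : OpenPartialHomeomorph M H} {e : OpenPartialHomeomorph H H}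
    (hc : c ∈ G.maximalAtlas M) (he : e ∈ G) : c ≫ₕ e ∈ G.maximalAtlas M := fun e' he' => by
  constructor
  · rw [OpenPartialHomeomorph.trans_symm_eq_symm_trans_symm, OpenPartialHomeomorph.trans_assoc]
    exact G.trans (G.symm he) (hc e' he').1
  · rw [← OpenPartialHomeomorph.trans_assoc]
    exact G.trans (hc e' he').2 he

/-- If in a chart onto `ℂ³` the set `S` is the part of the graph `a = g (ζ, b)` lying over real
`b ≥ 0`, then the sheared chart is a half-space slice chart for `S`. -/
lemma isSliceChart_shear {M : Type*} [TopologicalSpace M] {S : Set M}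
    {c : OpenPartialHomeomorph M (ℂ × ℂ × ℂ)} (hc : c.target = univ) {g : ℂ × ℂ → ℂ}
    (hg : Continuous g)
    (hS : ∀ p, c.symm p ∈ S ↔ p.2.2.im = 0 ∧ 0 ≤ p.2.2.re ∧ p.2.1 = g (p.1, p.2.2)) :
    HalfSlice.IsSliceChart splitting S (c ≫ₕ (shear g hg).toOpenPartialHomeomorph) where
  target_eq := by simp [hc]
  mem_iff p := by
    change c.symm ((shear g hg).symm (splitting p)) ∈ S ↔ _
    rw [hS, splitting_apply]
    simp only [shear, Homeomorph.symm, Homeomorph.homeomorph_mk_coe, Equiv.symm, Equiv.coe_fn_mk,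
      add_eq_right, Prod.ext_iff, Prod.fst_zero, Prod.snd_zero]
    tauto

/-! ### Real points and stereographic projection -/

/-- Reality of `(z₁, z₂, z₃)` in the coordinates of `W_k`, for a fixed value `c` of `z₄^k`. The
real points form the sphere `z₁² + z₂² + z₃² = c²`, on which `ζ` is a stereographic coordinate, so
`a` is determined by `ζ`. -/
lemma real_iff_eq_stereographic (c : ℝ) (ζ a : ℂ) :
    ((a - (ζ ^ 2 * a + ζ * c)).im = 0 ∧ (Complex.I * (a + (ζ ^ 2 * a + ζ * c))).im = 0 ∧
      (2 * ζ * a + c).im = 0) ↔ a = (-(c / (1 + ‖ζ‖ ^ 2)) : ℝ) • (starRingEnd ℂ) ζ := by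
  have hpos : (1 + ‖ζ‖ ^ 2 : ℝ) ≠ 0 := by positivity
  obtain ⟨r, hr⟩ : ∃ r : ℝ, c / (1 + ‖ζ‖ ^ 2) = r := ⟨_, rfl⟩
  rw [hr]
  rw [div_eq_iff hpos] at hr
  rw [← Complex.normSq_eq_norm_sq] at hr hpos
  obtain ⟨x, y⟩ := ζ
  obtain ⟨u, v⟩ := a
  simp only [Complex.normSq_mk] at hr hpos
  simp only [Complex.ext_iff]
  simp [pow_two]
  constructor
  · rintro ⟨h1, h2, h3⟩
    -- `ζ a` is real and `ζ (ζ a + c) = -ā`; multiplying by `ζ̄` determines `ζ a + c`.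
    have hs : x * u - y * v + c = r := by
      apply mul_right_cancel₀ hpos
      rw [← hr]
      linear_combination x * h2 - y * h1
    constructor
    · linear_combination h2 - x * hs + y / 2 * h3
    · linear_combination h1 + y * hs + x / 2 * h3
  · rintro ⟨rfl, rfl⟩
    subst hr
    refine ⟨?_, ?_, ?_⟩ <;> ring

end OneConvex
end

/-! ### The closure of `A` -/

noncomputable section

namespace OneConvex

open Set Topology

/-- The closed set of real points `z` of `ℂ⁴` with `z₄ ≥ 0`. -/
def realHalf : Set (Fin 4 → ℂ) := {z | (∀ i, (z i).im = 0) ∧ 0 ≤ (z 3).re}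

lemma isClosed_realHalf : IsClosed realHalf := by
  have h (i : Fin 4) : IsClosed {z : Fin 4 → ℂ | (z i).im = 0} :=
    isClosed_eq (Complex.continuous_im.comp (continuous_apply i)) continuous_const
  have h3 : IsClosed {z : Fin 4 → ℂ | 0 ≤ (z 3).re} :=
    isClosed_le continuous_const (Complex.continuous_re.comp (continuous_apply 3))
  rw [realHalf, ofPred_and, ofPred_forall]
  exact (isClosed_iInter h).inter h3

lemma continuous_f (k : ℕ) : Continuous (f k) := by
  unfold f blowDown
  fun_prop

/-- The only real point of `Y_k` with `z₄ = 0` is the origin, since there `z₁² + z₂² + z₃² = 0`. -/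
lemma A_union_C (k : ℕ) (hk : 1 ≤ k) : A k ∪ C k = f k ⁻¹' realHalf := by
  ext x
  constructor
  · rintro (hx | hx)
    · exact ⟨hx.2.1, hx.2.2.le⟩
    · have h0 : f k x = 0 := hx
      simp [realHalf, h0]
  · rintro ⟨hre, hx⟩
    rcases hx.lt_or_eq with hx | hx
    · exact Or.inl ⟨f_mem_Y x, hre, hx⟩
    · refine Or.inr (?_ : f k x = 0)
      have hY : f k x ∈ Y k := f_mem_Y x
      generalize f k x = z at *
      have h3 : z 3 = 0 := Complex.ext hx.symm (hre 3)
      have hY' := congrArg Complex.re (show z 0 ^ 2 + z 1 ^ 2 + z 2 ^ 2 - z 3 ^ (2 * k) = 0 from hY)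
      rw [h3, zero_pow (by lia)] at hY'
      simp only [pow_two, Complex.sub_re, Complex.add_re, Complex.mul_re, hre,
        Complex.zero_re] at hY'
      have h0 : (z 0).re = 0 := by nlinarith [sq_nonneg (z 1).re, sq_nonneg (z 2).re]
      have h1 : (z 1).re = 0 := by nlinarith [sq_nonneg (z 0).re, sq_nonneg (z 2).re]
      have h2 : (z 2).re = 0 := by nlinarith [sq_nonneg (z 0).re, sq_nonneg (z 1).re]
      ext i
      fin_cases i
      · exact Complex.ext h0 (hre 0)
      · exact Complex.ext h1 (hre 1)
      · exact Complex.ext h2 (hre 2)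
      · exact h3

/-- The function `(ζ, b) ↦ -s (Re b)^k ζ̄ / (1 + |ζ|²)`, whose graph over real `b ≥ 0` is the closure
of `A`, with sign `s = 1` in the chart `(ζ, x₁, x₂)` and `s = -1` in the chart `(w, y₁, y₂)`. -/
def graphFun (k : ℕ) (s : ℝ) (q : ℂ × ℂ) : ℂ :=
  (-(s * q.2.re ^ k / (1 + ‖q.1‖ ^ 2)) : ℝ) • (starRingEnd ℂ) q.1

lemma contDiff_graphFun (k : ℕ) (s : ℝ) : ContDiff ℝ ∞ (graphFun k s) := by
  have hre : ContDiff ℝ ∞ fun q : ℂ × ℂ => q.2.re := Complex.reCLM.contDiff.comp contDiff_snd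
  have hconj : ContDiff ℝ ∞ fun q : ℂ × ℂ => (starRingEnd ℂ) q.1 :=
    Complex.conjCLE.contDiff.comp contDiff_fst
  have hn : ContDiff ℝ ∞ fun q : ℂ × ℂ => ‖q.1‖ ^ 2 := contDiff_fst.norm_sq ℝ
  exact (((contDiff_const.mul (hre.pow k)).div (contDiff_const.add hn)
    fun q => by positivity).neg).smul hconj

lemma ofReal_mul_re_pow {b : ℂ} (hb : b.im = 0) (s : ℝ) (k : ℕ) :
    ((s * b.re ^ k : ℝ) : ℂ) = s * b ^ k := by
  rw [Complex.ofReal_mul, Complex.ofReal_pow, (Complex.ext rfl hb.symm : (b.re : ℂ) = b)]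

lemma chartZ_symm_mem_iff (k : ℕ) (p : ℂ × ℂ × ℂ) :
    (chartZ k).symm p ∈ f k ⁻¹' realHalf ↔
      p.2.2.im = 0 ∧ 0 ≤ p.2.2.re ∧ p.2.1 = graphFun k 1 (p.1, p.2.2) := by
  obtain ⟨ζ, a, b⟩ := p
  change (∀ i, (vecZ k (ζ, a, b) i).im = 0) ∧ 0 ≤ b.re ↔ b.im = 0 ∧ 0 ≤ b.re ∧ a = _
  have key := real_iff_eq_stereographic (1 * b.re ^ k) ζ a
  constructor
  · rintro ⟨h, h0⟩
    rw [ofReal_mul_re_pow (b := b) (h 3), Complex.ofReal_one, one_mul (b ^ k)] at key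
    exact ⟨h 3, h0, key.1 ⟨h 0, h 1, h 2⟩⟩
  · rintro ⟨h3, h0, h⟩
    rw [ofReal_mul_re_pow h3, Complex.ofReal_one, one_mul (b ^ k)] at key
    obtain ⟨h0', h1', h2'⟩ := key.2 h
    refine ⟨fun i => ?_, h0⟩
    fin_cases i
    exacts [h0', h1', h2', h3]

lemma chartW_symm_mem_iff (k : ℕ) (p : ℂ × ℂ × ℂ) :
    (chartW k).symm p ∈ f k ⁻¹' realHalf ↔
      p.2.2.im = 0 ∧ 0 ≤ p.2.2.re ∧ p.2.1 = graphFun k (-1) (p.1, p.2.2) := by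
  obtain ⟨w, a, b⟩ := p
  change (∀ i, (vecW k (w, a, b) i).im = 0) ∧ 0 ≤ b.re ↔ b.im = 0 ∧ 0 ≤ b.re ∧ a = _
  have key := real_iff_eq_stereographic (-1 * b.re ^ k) w a
  -- Up to the sign of the first coordinate, `vecW` is `vecZ` with `b ^ k` replaced by `-b ^ k`.
  have e0 : a - (w ^ 2 * a + w * (-b ^ k)) = -vecW k (w, a, b) 0 := by
    simp only [vecW, Matrix.cons_val_zero]; ring
  have e1 : Complex.I * (a + (w ^ 2 * a + w * (-b ^ k))) = vecW k (w, a, b) 1 := by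
    simp only [vecW, Matrix.cons_val_one, Matrix.cons_val_zero]; ring
  have e2 : 2 * w * a + -b ^ k = vecW k (w, a, b) 2 := (sub_eq_add_neg _ _).symm
  constructor
  · rintro ⟨h, h0⟩
    rw [ofReal_mul_re_pow (b := b) (h 3), Complex.ofReal_neg, Complex.ofReal_one, neg_one_mul (b ^ k),
      e0, e1, e2, Complex.neg_im, neg_eq_zero] at key
    exact ⟨h 3, h0, key.1 ⟨h 0, h 1, h 2⟩⟩
  · rintro ⟨h3, h0, h⟩
    rw [ofReal_mul_re_pow h3, Complex.ofReal_neg, Complex.ofReal_one, neg_one_mul (b ^ k),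
      e0, e1, e2, Complex.neg_im, neg_eq_zero] at key
    obtain ⟨h0', h1', h2'⟩ := key.2 h
    refine ⟨fun i => ?_, h0⟩
    fin_cases i
    exacts [h0', h1', h2', h3]

/-- The two charts of `W_k`. -/
def chart (k : ℕ) (i : Bool) : OpenPartialHomeomorph (W k) (ℂ × ℂ × ℂ) :=
  if i then chartZ k else chartW k

/-- The sign of `graphFun` in each of the two charts. -/
def chartSign (i : Bool) : ℝ := if i then 1 else -1

lemma chart_target (k : ℕ) (i : Bool) : (chart k i).target = univ := by
  cases i <;> rfl

lemma chart_mem_atlas (k : ℕ) (i : Bool) : chart k i ∈ atlas (ℂ × ℂ × ℂ) (W k) := by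
  rw [atlas_eq]
  cases i <;> simp [chart]

lemma exists_mem_chart_source {k : ℕ} (x : W k) : ∃ i, x ∈ (chart k i).source :=
  (domZ_or_domW x.1.1.2).elim (fun h => ⟨true, h⟩) fun h => ⟨false, h⟩

lemma chart_apply_snd_snd {k : ℕ} (i : Bool) (x : W k) : (chart k i x).2.2 = f k x 3 := by
  cases i <;> rfl

lemma chart_symm_mem_iff (k : ℕ) (i : Bool) (p : ℂ × ℂ × ℂ) :
    (chart k i).symm p ∈ f k ⁻¹' realHalf ↔
      p.2.2.im = 0 ∧ 0 ≤ p.2.2.re ∧ p.2.1 = graphFun k (chartSign i) (p.1, p.2.2) := by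
  cases i
  · exact chartW_symm_mem_iff k p
  · exact chartZ_symm_mem_iff k p

/-- The closure of `A`. A point of `f⁻¹(realHalf)` is approached from within `A` along the graph,
by increasing the coordinate `z₄`. -/
lemma closure_A (k : ℕ) (hk : 1 ≤ k) : closure (A k) = f k ⁻¹' realHalf := by
  refine (closure_minimal (subset_union_left.trans (A_union_C k hk).subset)
    (isClosed_realHalf.preimage (continuous_f k))).antisymm fun x hx => ?_
  obtain ⟨i, hi⟩ := exists_mem_chart_source x
  obtain ⟨⟨ζ, a, b⟩, hp⟩ : ∃ p, chart k i x = p := ⟨_, rfl⟩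
  have hxp : (chart k i).symm (ζ, a, b) = x := by rw [← hp, (chart k i).left_inv hi]
  rw [← hxp, chart_symm_mem_iff] at hx
  obtain ⟨hb, hb0, ha⟩ := hx
  dsimp only at hb hb0
  obtain rfl : a = graphFun k (chartSign i) (ζ, b) := ha
  let γ (t : ℝ) : W k := (chart k i).symm (ζ, graphFun k (chartSign i) (ζ, b + t), b + t)
  have hγ : Continuous γ := by
    have hc : Continuous (chart k i).symm := by
      rw [← continuousOn_univ, ← chart_target k i]
      exact (chart k i).continuousOn_symm
    have := (contDiff_graphFun k (chartSign i)).continuous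
    exact hc.comp (by fun_prop)
  have hγ0 : γ 0 = x := by simp [γ, hxp]
  refine mem_closure_of_tendsto (b := 𝓝[>] (0 : ℝ)) (f := γ)
    (hγ0 ▸ (hγ.tendsto 0).mono_left nhdsWithin_le_nhds) ?_
  filter_upwards [self_mem_nhdsWithin] with t (ht : 0 < t)
  have hmem : γ t ∈ f k ⁻¹' realHalf := by
    rw [chart_symm_mem_iff]
    refine ⟨by simpa using hb, ?_, rfl⟩
    simp; linarith
  refine ⟨f_mem_Y _, hmem.1, ?_⟩
  rw [← chart_apply_snd_snd i, (chart k i).right_inv (chart_target k i ▸ mem_univ _)]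
  simp; linarith

end OneConvex
end

theorem corollaryG (k : ℕ) (hk : 1 ≤ k) :
    closure (OneConvex.A k) = OneConvex.A k ∪ OneConvex.C k ∧
    Disjoint (OneConvex.A k) (OneConvex.C k) ∧
    ∃ _ : ChartedSpace (EuclideanHalfSpace 3) (closure (OneConvex.A k)),
      IsManifold (𝓡∂ 3) ∞ (closure (OneConvex.A k)) ∧
      Manifold.IsSmoothEmbedding (𝓡∂ 3) 𝓘(ℝ, ℂ × ℂ × ℂ) ∞
        (Subtype.val : closure (OneConvex.A k) → OneConvex.W k) ∧
      (𝓡∂ 3).interior (closure (OneConvex.A k)) = Subtype.val ⁻¹' OneConvex.A k ∧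
      (𝓡∂ 3).boundary (closure (OneConvex.A k)) = Subtype.val ⁻¹' OneConvex.C k := by
  have hcl : closure (OneConvex.A k) = OneConvex.A k ∪ OneConvex.C k :=
    (OneConvex.closure_A k hk).trans (OneConvex.A_union_C k hk).symm
  have hdisj : Disjoint (OneConvex.A k) (OneConvex.C k) := by
    refine Set.disjoint_left.2 fun x hA hC => ?_
    have h0 : OneConvex.f k x = 0 := hC
    have h3 : 0 < (OneConvex.f k x 3).re := hA.2.2
    simp [h0] at h3
  refine ⟨hcl, hdisj, ?_⟩
  obtain ⟨cs, hm, hemb, hint⟩ := HalfSlice.exists_manifold_structure OneConvex.splitting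
    (closure (OneConvex.A k))
    (fun i => OneConvex.chart k i ≫ₕ (OneConvex.shear _
      (OneConvex.contDiff_graphFun k (OneConvex.chartSign i)).continuous).toOpenPartialHomeomorph)
    (fun i => StructureGroupoid.trans_mem_maximalAtlas
      (IsManifold.subset_maximalAtlas (OneConvex.chart_mem_atlas k i))
      (OneConvex.shear_mem_contDiffGroupoid (OneConvex.contDiff_graphFun k _)))
    (fun i => OneConvex.isSliceChart_shear (OneConvex.chart_target k i) _ fun p => by
      rw [OneConvex.closure_A k hk, OneConvex.chart_symm_mem_iff])
    (fun x _ => by simpa using OneConvex.exists_mem_chart_source x)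
  have hinterior : (𝓡∂ 3).interior (closure (OneConvex.A k)) = Subtype.val ⁻¹' OneConvex.A k := by
    ext x
    obtain ⟨i, -, hi⟩ := hint x
    have hx : x.1 ∈ OneConvex.f k ⁻¹' OneConvex.realHalf := OneConvex.closure_A k hk ▸ x.2
    change (𝓡∂ 3).IsInteriorPoint x ↔ _
    rw [hi, OneConvex.splitting_symm_zero]
    change 0 < (OneConvex.chart k i x.1).2.2.re ↔ _
    rw [OneConvex.chart_apply_snd_snd]
    exact ⟨fun h => ⟨OneConvex.f_mem_Y x.1, hx.1, h⟩, fun h => h.2.2⟩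
  refine ⟨cs, hm, hemb, hinterior, ?_⟩
  rw [← ModelWithCorners.compl_interior, hinterior]
  ext x
  have hx : x.1 ∈ OneConvex.A k ∪ OneConvex.C k := hcl ▸ x.2
  exact ⟨hx.resolve_left, fun hC hA => Set.disjoint_left.1 hdisj hA hC⟩
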